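/- Online monotone submodular maximization under a cardinality constraint. An input consists of an integer $k\ge 0$, a finite ground set $X$ of $n$ elements that arrive one by one in an order $x_1,\dots,x_n$, and a function $f:2^X\to\mathbb{R}_{\ge 0}$ that is monotone ($f(T\cup\{x\})\ge f(T)$ for all $x\in X$, $T\subseteq X$) and submodular ($f(S\cup\{x\})-f(S)\ge f(T\cup\{x\})-f(T)$ for all $S\subseteq T\subseteq X$ and $x\in X\setminus T$). Let $X_t=\{x_1,\dots,x_t\}$. A randomized online algorithm (with no restriction on its running time or other computational resources) outputs after each arrival a set $\mathrm{ALG}_t\subseteq X_t$ with $|\mathrm{ALG}_t|\le k$, with $\mathrm{ALG}_0=\emptyset$. This set may depend only on $k$, on the algorithm's random bits, on the order of the arrivals so far and on the values $f(S)$ for $S\subseteq X_t$; in particular the algorithm knows neither $n$ nor values of $f$ on sets containing future elements. The input is fixed independently of the random bits (oblivious adversary). Let $\mathrm{OPT}_t$ be a set maximizing $f$ among all $S\subseteq X_t$ with $|S|\le k$. **Theorem.** There are absolute constants $C,K>0$ such that for every $\varepsilon\in(0,1)$ there is a randomized online algorithm which, on every input, satisfies: 1. (consistency) for every outcome of the random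 bits and every $1\le t\le n$, $|\mathrm{ALG}_t\setminus \mathrm{ALG}_{t-1}|\le C/\varepsilon^2$; 2. (approximation) for every $t\le n$, $\mathbb{E}[f(\mathrm{ALG}_t)]\ge\left(\tfrac23-K\varepsilon\right) f(\mathrm{OPT}_t)$. -/

import Mathlib

open MeasureTheory

/-- The marginal gain `f(S | T) = f(S ∪ T) - f(T)`. -/
def marginal {X : Type*} [DecidableEq X] (f : Finset X → ℝ) (S T : Finset X) : ℝ :=
  f (S ∪ T) - f T

/-- `f : 2^X → ℝ` is a non-negative monotone submodular set function. -/
structure IsMonotoneSubmodular {X : Type*} [DecidableEq X] (f : Finset X → ℝ) : Prop where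
  nonneg : ∀ S, 0 ≤ f S
  monotone : ∀ (x : X) (T : Finset X), 0 ≤ marginal f {x} T
  submodular : ∀ (S T : Finset X), S ⊆ T → ∀ x ∉ T, marginal f {x} T ≤ marginal f {x} S

/-- A randomized online algorithm for cardinality-constrained set function maximization, with no
restriction on its computational resources.

The random bits are one outcome `ω` of a probability space which is fixed before the input.
Arrived elements are named by their position in the arrival order, so that after `t` arrivals
the arrived elements are `Fin t`. At that time the algorithm knows the cardinality bound `k`,
its random bits, and the value oracle `v : Finset (Fin t) → ℝ`, that is the value of every
set of arrived elements (hence also everything it saw and did before), and nothing else; in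
particular neither the length of the stream nor any value involving a future element.
It returns its current solution, which is a set of arrived elements. -/
structure RandomizedOnlineAlgorithm where
  /-- the random bits -/
  Ω : Type
  [measurableSpace : MeasurableSpace Ω]
  /-- the law of the random bits -/
  law : Measure Ω
  [isProbabilityMeasure : IsProbabilityMeasure law]
  /-- the solution after `t` arrivals -/
  select : (k : ℕ) → Ω → (t : ℕ) → (v : Finset (Fin t) → ℝ) → Finset (Fin t)
  /-- the solution, as a function of the random bits, is a random variable -/
  measurableSet_select : ∀ (k t : ℕ) (v : Finset (Fin t) → ℝ) (S : Finset (Fin t)),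
    MeasurableSet {ω | select k ω t v = S}

attribute [instance] RandomizedOnlineAlgorithm.measurableSpace
attribute [instance] RandomizedOnlineAlgorithm.isProbabilityMeasure

section Stream

variable {X : Type*} {n t : ℕ}

/-- The first `t` arrivals of a stream `x` that enumerates a ground set of `n` elements. -/
def arrival (x : Fin n ≃ X) (ht : t ≤ n) : Fin t ↪ X :=
  (Fin.castLEEmb ht).trans x.toEmbedding

/-- `X_t`, the set of elements that arrive in the first `t` time steps. -/
def arrivedSet (x : Fin n ≃ X) (ht : t ≤ n) : Finset X :=
  Finset.univ.map (arrival x ht)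

/-- The value oracle at time `t`: the function `f` on the sets of arrived elements. -/
def valueOracle (f : Finset X → ℝ) (x : Fin n ≃ X) (ht : t ≤ n) : Finset (Fin t) → ℝ :=
  fun S => f (S.map (arrival x ht))

/-- `ALG_t`, the solution of the algorithm `A` after `t` arrivals on random bits `ω`. -/
def RandomizedOnlineAlgorithm.solution (A : RandomizedOnlineAlgorithm) (k : ℕ)
    (f : Finset X → ℝ) (x : Fin n ≃ X) (ht : t ≤ n) (ω : A.Ω) : Finset X :=
  (A.select k ω t (valueOracle f x ht)).map (arrival x ht)

/-- `f(OPT_t)`, the maximum of `f` over the sets of at most `k` arrived elements. -/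
noncomputable def optValue (k : ℕ) (f : Finset X → ℝ) (x : Fin n ≃ X) (ht : t ≤ n) : ℝ :=
  ((arrivedSet x ht).powerset.filter (fun S => S.card ≤ k)).sup' ⟨∅, by simp⟩ f

end Stream

universe u

/-- Every solution of `A` has at most `k` elements, on all inputs and for all random bits. -/
def RandomizedOnlineAlgorithm.IsFeasible (A : RandomizedOnlineAlgorithm) : Prop :=
  ∀ (k n : ℕ) (X : Type u) [DecidableEq X] (x : Fin n ≃ X) (f : Finset X → ℝ),
    IsMonotoneSubmodular f →
      ∀ (t : ℕ) (ht : t ≤ n) (ω : A.Ω), (A.solution k f x ht ω).card ≤ k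

/-- `A` is `C`-consistent: `|ALG_t \ ALG_{t-1}| ≤ C` at every time step, on all inputs and for
all random bits. -/
def RandomizedOnlineAlgorithm.IsConsistent (A : RandomizedOnlineAlgorithm) (C : ℝ) : Prop :=
  ∀ (k n : ℕ) (X : Type u) [DecidableEq X] (x : Fin n ≃ X) (f : Finset X → ℝ),
    IsMonotoneSubmodular f →
      ∀ (t : ℕ) (ht : t + 1 ≤ n) (ω : A.Ω),
        ((A.solution k f x ht ω \
          A.solution k f x ((Nat.le_succ t).trans ht) ω).card : ℝ) ≤ C

/-- `A` is an `α`-approximation of the dynamic optimum: `E[f(ALG_t)] ≥ α f(OPT_t)` at every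
time step, on all inputs. The input is chosen before the random bits are drawn
(oblivious adversary). -/
def RandomizedOnlineAlgorithm.IsApproximation (A : RandomizedOnlineAlgorithm) (α : ℝ) : Prop :=
  ∀ (k n : ℕ) (X : Type u) [DecidableEq X] (x : Fin n ≃ X) (f : Finset X → ℝ),
    IsMonotoneSubmodular f →
      ∀ (t : ℕ) (ht : t ≤ n),
        α * optValue k f x ht ≤ ∫ ω, f (A.solution k f x ht ω) ∂A.law

/-!
The algorithm rests on a pair of sets whose random choice is robust under additions. Among the
elements of a prefix of the stream, let `S₁` maximize `h` and let `S₂` maximize the marginal value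
over `S₁`. Let `O` be any competitor from that prefix, and `R` any set of later elements. Then
`h (O ∪ R)` is at most `h (R ∪ S₁) + h(S₂ ∣ S₁)`, since `h(O ∣ R ∪ S₁) ≤ h(O ∣ S₁) ≤ h(S₂ ∣ S₁)`, and
it is at most `h R + h S₁`. Add the two bounds and use submodularity for `R ∪ S₁` and `R ∪ S₂`:
`2 h (O ∪ R) ≤ 2 h (R ∪ S₁) + h (R ∪ S₂)`. So `S₁` with probability `2/3` and `S₂` with probability
`1/3`, together with `R`, give a `2/3`-approximation, no matter how the later elements interact
with the earlier ones (`LatticeSubmodular.robust_pair`).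

With `m` about `1/ε`, time is divided into phases of about `k / m` steps. The solution always keeps
all arrivals since the beginning of the previous phase, at most `2k / m` elements, and fills
the remaining space with one set of a robust pair (a core), at a loss of a factor `1 - 2 / m`
(`LatticeSubmodular.exists_subset_card_le`). In each phase the core of the previous phase has to be
replaced by that of the prefix seen at the beginning of the phase. The solution may be worthless
while this happens. Hence the replacement is confined to one of the `m` blocks of the phase, of
about `k / m ^ 2` steps, chosen at random in advance: `O(m ^ 2)` additions per step suffice, and at
every fixed time the core is incomplete with probability at most `1 / m`. Before and after its
block the solution holds a complete core, and all elements that arrived after the prefix of this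
core, so robustness applies (`LatticeSubmodular.sum_schedule_ge`). If `k < m ^ 2`, an optimal
solution can be output at every step.

Since the core of a phase has to be recomputed identically at all times of the phase, elements are
identified with their positions in the stream, and the schedule is analysed for functions on
`Finset ℕ`. Only at the end is it pulled back to the ground set.
-/

/-! ### Monotone submodular functions -/

/-- Monotone submodular set functions in lattice form: `h` is non-negative, monotone, and
`h (A ∪ B) + h (A ∩ B) ≤ h A + h B`. This form passes along maps that preserve unions and
intersections. -/
structure LatticeSubmodular {α : Type*} [DecidableEq α] (h : Finset α → ℝ) : Prop where
  nonneg : ∀ S, 0 ≤ h S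
  mono : ∀ A B, A ⊆ B → h A ≤ h B
  union_inter : ∀ A B, h (A ∪ B) + h (A ∩ B) ≤ h A + h B

theorem IsMonotoneSubmodular.latticeSubmodular {α : Type*} [DecidableEq α] {f : Finset α → ℝ}
    (hf : IsMonotoneSubmodular f) : LatticeSubmodular f := by
  have insert_le : ∀ (x : α) (T : Finset α), f T ≤ f (insert x T) := by
    intro x T
    have := hf.monotone x T
    rw [marginal, ← Finset.insert_eq] at this
    linarith
  have union_le : ∀ A D : Finset α, f A ≤ f (A ∪ D) := by
    intro A D
    induction D using Finset.induction_on with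
    | empty => simp
    | insert x D _ ih =>
      rw [Finset.union_insert]
      exact ih.trans (insert_le _ _)
  have sub_insert : ∀ (x : α) (S T : Finset α), S ⊆ T → x ∉ T →
      f (insert x T) - f T ≤ f (insert x S) - f S := by
    intro x S T hST hx
    have := hf.submodular S T hST x hx
    rwa [marginal, marginal, ← Finset.insert_eq, ← Finset.insert_eq] at this
  have key : ∀ D S T : Finset α, S ⊆ T → Disjoint D T →
      f (T ∪ D) - f T ≤ f (S ∪ D) - f S := by
    intro D S T hST
    induction D using Finset.induction_on with
    | empty => simp
    | insert x D hx ih =>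
      intro hd
      rw [Finset.disjoint_insert_left] at hd
      have h1 := ih hd.2
      have h2 := sub_insert x (S ∪ D) (T ∪ D) (Finset.union_subset_union_left hST)
        (by simp [hx, hd.1])
      rw [Finset.union_insert, Finset.union_insert]
      linarith
  refine ⟨hf.nonneg, fun A B hAB => ?_, fun A B => ?_⟩
  · rw [← Finset.union_eq_right.2 hAB]
    exact union_le A B
  · have := key (A \ B) (A ∩ B) B Finset.inter_subset_right Finset.sdiff_disjoint
    rw [Finset.union_sdiff_self_eq_union, Finset.union_comm B A, Finset.union_comm (A ∩ B),
      Finset.sdiff_union_inter] at this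
    linarith

section LatticeSubmodular

variable {α : Type*} [DecidableEq α] {h : Finset α → ℝ}

theorem LatticeSubmodular.union_le_add (hh : LatticeSubmodular h) (A B : Finset α) :
    h (A ∪ B) ≤ h A + h B := by
  linarith [hh.union_inter A B, hh.nonneg (A ∩ B)]

/-- Marginal gains decrease: `h(O ∣ S ∪ R) ≤ h(O ∣ S)`. -/
theorem LatticeSubmodular.marginal_anti (hh : LatticeSubmodular h) (O S R : Finset α) :
    h (O ∪ (S ∪ R)) + h S ≤ h (S ∪ R) + h (O ∪ S) := by
  have h1 := hh.union_inter (S ∪ R) (O ∪ S)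
  have h2 := hh.mono S ((S ∪ R) ∩ (O ∪ S))
    (Finset.subset_inter Finset.subset_union_left Finset.subset_union_right)
  have h3 : S ∪ R ∪ (O ∪ S) = O ∪ (S ∪ R) := by
    ext a
    simp only [Finset.mem_union]
    tauto
  rw [h3] at h1
  linarith

/-- The marginal gains over a fixed set form a monotone submodular function. -/
theorem LatticeSubmodular.marginal (hh : LatticeSubmodular h) (T : Finset α) :
    LatticeSubmodular (fun S => h (S ∪ T) - h T) := by
  refine ⟨fun S => ?_, fun A B hAB => ?_, fun A B => ?_⟩
  · linarith [hh.mono T (S ∪ T) Finset.subset_union_right]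
  · linarith [hh.mono _ _ (Finset.union_subset_union_left (t := T) hAB)]
  · have := hh.union_inter (A ∪ T) (B ∪ T)
    rw [← Finset.union_union_distrib_right, ← Finset.inter_union_distrib_right] at this
    linarith

/-- The losses from deleting single elements of `O` sum to at most the whole value. -/
theorem LatticeSubmodular.sum_erase_loss_le (hh : LatticeSubmodular h) (O : Finset α) :
    ∑ x ∈ O, (h O - h (O.erase x)) ≤ h O := by
  have key : ∀ T ⊆ O, ∑ x ∈ T, (h O - h (O.erase x)) ≤ h T := by
    intro T
    induction T using Finset.induction_on with
    | empty => simpa using hh.nonneg ∅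
    | insert x T hx ih =>
      intro hT
      rw [Finset.insert_subset_iff] at hT
      have h1 := hh.union_inter (insert x T) (O.erase x)
      have h2 : insert x T ∪ O.erase x = O := by
        ext a
        have := @hT.2 a
        have := hT.1
        simp only [Finset.mem_union, Finset.mem_insert, Finset.mem_erase]
        grind
      have h3 : insert x T ∩ O.erase x = T := by
        ext a
        have := @hT.2 a
        simp only [Finset.mem_inter, Finset.mem_insert, Finset.mem_erase]
        grind
      rw [h2, h3] at h1
      rw [Finset.sum_insert hx]
      linarith [ih hT.2]
  exact key O subset_rfl

/-- Deleting the cheapest elements one by one, a set of `r` elements shrinks to one of `b`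
elements that keeps a `b / r` fraction of the value. -/
theorem LatticeSubmodular.exists_subset_card_eq (hh : LatticeSubmodular h) (b : ℕ) :
    ∀ r, b ≤ r → ∀ O : Finset α, O.card = r →
      ∃ S ⊆ O, S.card = b ∧ (b : ℝ) * h O ≤ r * h S := by
  intro r hr
  induction r, hr using Nat.le_induction with
  | base => exact fun O hO => ⟨O, subset_rfl, hO, le_rfl⟩
  | succ r hr ih =>
    intro O hO
    have hne : O.Nonempty := Finset.card_pos.1 (by omega)
    obtain ⟨x, hx, hle⟩ : ∃ x ∈ O, h O - h (O.erase x) ≤ h O / (r + 1) := by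
      apply Finset.exists_le_of_sum_le hne
      rw [Finset.sum_const, hO, nsmul_eq_mul]
      push_cast
      rw [mul_div_cancel₀ _ (by positivity : (r : ℝ) + 1 ≠ 0)]
      exact hh.sum_erase_loss_le O
    obtain ⟨S, hS, hcard, hval⟩ := ih (O.erase x) (by rw [Finset.card_erase_of_mem hx]; omega)
    refine ⟨S, hS.trans (Finset.erase_subset _ _), hcard, ?_⟩
    have hpos : (0 : ℝ) < r + 1 := by positivity
    have h1 : (r : ℝ) * h O ≤ (r + 1) * h (O.erase x) := by
      have : h O / (r + 1) * (r + 1) = h O := div_mul_cancel₀ _ hpos.ne'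
      nlinarith
    rcases Nat.eq_zero_or_pos r with rfl | hr0
    · have : b = 0 := by omega
      subst this
      simpa using hh.nonneg S
    · have hr0' : (0 : ℝ) < r := by exact_mod_cast hr0
      have hb : (0 : ℝ) ≤ b := by positivity
      have h2 : (r : ℝ) * (b * h O) ≤ r * ((r + 1) * h S) := by
        nlinarith [mul_le_mul_of_nonneg_left h1 hb, mul_le_mul_of_nonneg_left hval hpos.le]
      push_cast
      exact le_of_mul_le_mul_left h2 hr0'

theorem LatticeSubmodular.exists_subset_card_le (hh : LatticeSubmodular h) {b k : ℕ}
    (hbk : b ≤ k) {O : Finset α} (hO : O.card ≤ k) :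
    ∃ S ⊆ O, S.card ≤ b ∧ (b : ℝ) * h O ≤ k * h S := by
  rcases le_total O.card b with hle | hle
  · exact ⟨O, subset_rfl, hle, mul_le_mul_of_nonneg_right (by exact_mod_cast hbk) (hh.nonneg O)⟩
  · obtain ⟨S, hS, hc, hv⟩ := hh.exists_subset_card_eq b O.card hle O rfl
    exact ⟨S, hS, hc.le, hv.trans
      (mul_le_mul_of_nonneg_right (by exact_mod_cast hO) (hh.nonneg S))⟩

/-- Robustness of a pair `S₁`, `S₂` under additions. If `S₁` competes with `O` in value and `S₂`
competes with `O` in marginal value over `S₁`, up to the factor `θ`, then choosing `S₁` with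
probability `2/3` and `S₂` with probability `1/3` gives a `2θ/3` fraction of `h (O ∪ R)` once
`R` is added, for every `R`. -/
theorem LatticeSubmodular.robust_pair (hh : LatticeSubmodular h) {θ : ℝ} (h0 : 0 ≤ θ)
    (h1 : θ ≤ 1) {S₁ S₂ O : Finset α} (hS₁ : θ * h O ≤ h S₁)
    (hS₂ : θ * (h (O ∪ S₁) - h S₁) ≤ h (S₂ ∪ S₁) - h S₁) (R : Finset α) :
    2 * (θ * h (O ∪ R)) ≤ 2 * h (R ∪ S₁) + h (R ∪ S₂) := by
  -- `h(O ∪ R) ≤ h(S₁ ∪ R) + h(O ∣ S₁)` and `h(O ∪ R) ≤ h(R) + h(O)`; the sum is bounded by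
  -- `h(S₁ ∪ R) + h(S₁ ∪ S₂) + h(R)`, and submodularity applies to `S₁ ∪ R` and `S₂ ∪ R`.
  have a1 : h (O ∪ R) ≤ h (S₁ ∪ R) + (h (O ∪ S₁) - h S₁) := by
    have := hh.marginal_anti O S₁ R
    have := hh.mono (O ∪ R) (O ∪ (S₁ ∪ R))
      (Finset.union_subset_union_right Finset.subset_union_right)
    linarith
  have a2 := hh.union_le_add O R
  have a3 := hh.union_inter (R ∪ S₁) (R ∪ S₂)
  have a4 := hh.mono (S₂ ∪ S₁) (R ∪ S₁ ∪ (R ∪ S₂)) (by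
    intro a
    simp only [Finset.mem_union]
    tauto)
  have a5 := hh.mono R ((R ∪ S₁) ∩ (R ∪ S₂))
    (Finset.subset_inter Finset.subset_union_left Finset.subset_union_left)
  have b1 := mul_le_mul_of_nonneg_left a1 h0
  have b2 := mul_le_mul_of_nonneg_left a2 h0
  have b3 := mul_le_mul_of_nonneg_right h1 (hh.nonneg R)
  have b4 := mul_le_mul_of_nonneg_right h1 (hh.nonneg (S₁ ∪ R))
  rw [Finset.union_comm S₁ R] at b1 b4
  linarith

end LatticeSubmodular

/-! ### The robust pair of a prefix of the stream -/

/-- The function `h` as seen when only the elements `0, …, N - 1` have arrived. -/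
def truncate (N : ℕ) (h : Finset ℕ → ℝ) : Finset ℕ → ℝ :=
  fun S => h (S ∩ Finset.range N)

theorem truncate_truncate {N t : ℕ} (hN : N ≤ t) (h : Finset ℕ → ℝ) :
    truncate N (truncate t h) = truncate N h := by
  funext S
  simp only [truncate, Finset.inter_assoc]
  rw [Finset.inter_eq_left.2 (Finset.range_subset_range.2 hN)]

theorem truncate_apply {N : ℕ} {S : Finset ℕ} (hS : S ⊆ Finset.range N) (h : Finset ℕ → ℝ) :
    truncate N h S = h S := by
  rw [truncate, Finset.inter_eq_left.2 hS]

theorem exists_argmaxCard (g : Finset ℕ → ℝ) (N b : ℕ) :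
    ∃ S : Finset ℕ, (S ⊆ Finset.range N ∧ S.card ≤ b) ∧
      ∀ O : Finset ℕ, O ⊆ Finset.range N → O.card ≤ b → g O ≤ g S := by
  obtain ⟨S, hS, hmax⟩ := Finset.exists_max_image
    ((Finset.range N).powerset.filter (fun S => S.card ≤ b)) g ⟨∅, by simp⟩
  simp only [Finset.mem_filter, Finset.mem_powerset] at hS hmax
  exact ⟨S, hS, fun O h1 h2 => hmax O ⟨h1, h2⟩⟩

/-- A set maximizing `g` among the sets of at most `b` of the elements `0, …, N - 1`. -/
noncomputable def argmaxCard (g : Finset ℕ → ℝ) (N b : ℕ) : Finset ℕ :=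
  (exists_argmaxCard g N b).choose

section ArgmaxCard

variable (g h : Finset ℕ → ℝ) (N b : ℕ)

theorem argmaxCard_subset : argmaxCard g N b ⊆ Finset.range N :=
  (exists_argmaxCard g N b).choose_spec.1.1

theorem card_argmaxCard_le : (argmaxCard g N b).card ≤ b :=
  (exists_argmaxCard g N b).choose_spec.1.2

theorem le_argmaxCard {O : Finset ℕ} (hO : O ⊆ Finset.range N) (hb : O.card ≤ b) :
    g O ≤ g (argmaxCard g N b) :=
  (exists_argmaxCard g N b).choose_spec.2 O hO hb

/-- The first set of the robust pair: the best `b` of the first `N` elements. -/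
noncomputable def firstCore : Finset ℕ :=
  argmaxCard (truncate N h) N b

/-- The second set of the robust pair: the `b` of the first `N` elements with the largest marginal
value over the first set. -/
noncomputable def secondCore : Finset ℕ :=
  argmaxCard (fun S => truncate N h (S ∪ firstCore h N b)) N b

/-- The core picked by a random index `c`, such that a uniform `c` picks the first set of the
robust pair with probability `2/3` and the second set with probability `1/3`. -/
noncomputable def core (c : Fin 3) : Finset ℕ :=
  if c = 2 then secondCore h N b else firstCore h N b

theorem core_subset (c : Fin 3) : core h N b c ⊆ Finset.range N := by
  unfold core
  split_ifs <;> exact argmaxCard_subset _ _ _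

theorem card_core_le (c : Fin 3) : (core h N b c).card ≤ b := by
  unfold core
  split_ifs <;> exact card_argmaxCard_le _ _ _

/-- The robust pair of the first `N` elements depends only on the values of their subsets. -/
theorem core_truncate {t : ℕ} (hN : N ≤ t) (c : Fin 3) :
    core (truncate t h) N b c = core h N b c := by
  simp only [core, secondCore, firstCore, truncate_truncate hN]

end ArgmaxCard

/-- The value of a random core, together with arbitrary later elements `R`, against the value of
any set `Q` whose old elements are among the first `N` and whose other elements lie in `R`. -/
theorem LatticeSubmodular.sum_core_ge {h : Finset ℕ → ℝ} (hh : LatticeSubmodular h) {N b k : ℕ}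
    (hbk : b ≤ k) (hk : 0 < k) {Q R : Finset ℕ} (hQ : Q.card ≤ k)
    (hQR : Q ⊆ Finset.range N ∪ R) :
    2 * ((b : ℝ) / k * h Q) ≤ ∑ c : Fin 3, h (R ∪ core h N b c) := by
  set O := Q ∩ Finset.range N with hO
  have hON : O ⊆ Finset.range N := Finset.inter_subset_right
  have hOk : O.card ≤ k := (Finset.card_le_card Finset.inter_subset_left).trans hQ
  have hk' : (0 : ℝ) < k := by exact_mod_cast hk
  have hF : firstCore h N b ⊆ Finset.range N := argmaxCard_subset _ _ _
  have hG : secondCore h N b ⊆ Finset.range N := argmaxCard_subset _ _ _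
  have h1 : (b : ℝ) / k * h O ≤ h (firstCore h N b) := by
    obtain ⟨S, hS, hc, hv⟩ := hh.exists_subset_card_le hbk hOk
    have := le_argmaxCard (truncate N h) N b (hS.trans hON) hc
    rw [truncate_apply (hS.trans hON), truncate_apply (argmaxCard_subset _ _ _)] at this
    rw [div_mul_eq_mul_div, div_le_iff₀ hk', mul_comm (h _)]
    exact hv.trans (mul_le_mul_of_nonneg_left this hk'.le)
  have h2 : (b : ℝ) / k * (h (O ∪ firstCore h N b) - h (firstCore h N b)) ≤
      h (secondCore h N b ∪ firstCore h N b) - h (firstCore h N b) := by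
    obtain ⟨S, hS, hc, hv⟩ := (hh.marginal (firstCore h N b)).exists_subset_card_le hbk hOk
    have : truncate N h (S ∪ firstCore h N b) ≤
        truncate N h (secondCore h N b ∪ firstCore h N b) :=
      le_argmaxCard (fun S => truncate N h (S ∪ firstCore h N b)) N b (hS.trans hON) hc
    rw [truncate_apply (Finset.union_subset (hS.trans hON) hF),
      truncate_apply (Finset.union_subset hG hF)] at this
    rw [div_mul_eq_mul_div, div_le_iff₀ hk', mul_comm (_ - _) (k : ℝ)]
    refine hv.trans (mul_le_mul_of_nonneg_left ?_ hk'.le)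
    exact sub_le_sub_right this _
  have h3 := hh.robust_pair (by positivity)
    (div_le_one_of_le₀ (by exact_mod_cast hbk) hk'.le) h1 h2 R
  have h4 : h Q ≤ h (O ∪ R) := by
    apply hh.mono
    intro a ha
    have := hQR ha
    simp only [hO, Finset.mem_union, Finset.mem_inter] at this ⊢
    tauto
  have h5 : (b : ℝ) / k * h Q ≤ b / k * h (O ∪ R) :=
    mul_le_mul_of_nonneg_left h4 (by positivity)
  have e0 : core h N b 0 = firstCore h N b := rfl
  have e1 : core h N b 1 = firstCore h N b := rfl
  have e2 : core h N b 2 = secondCore h N b := rfl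
  rw [Fin.sum_univ_three, e0, e1, e2]
  linarith

/-! ### The schedule -/

/-- The first `a` elements of `S` in a fixed enumeration. -/
noncomputable def initialPart (S : Finset ℕ) (a : ℕ) : Finset ℕ :=
  (S.toList.take a).toFinset

theorem initialPart_subset (S : Finset ℕ) (a : ℕ) : initialPart S a ⊆ S := by
  intro x hx
  rw [initialPart, List.mem_toFinset] at hx
  exact Finset.mem_toList.1 (List.mem_of_mem_take hx)

theorem initialPart_eq_self {S : Finset ℕ} {a : ℕ} (ha : S.card ≤ a) : initialPart S a = S := by
  rw [initialPart, List.take_of_length_le (by simpa using ha), Finset.toList_toFinset]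

theorem card_initialPart_le (S : Finset ℕ) (a : ℕ) : (initialPart S a).card ≤ a :=
  (List.toFinset_card_le _).trans (by simp)

theorem card_initialPart_sdiff_le (S : Finset ℕ) (a q : ℕ) :
    (initialPart S (a + q) \ initialPart S a).card ≤ q := by
  have : initialPart S (a + q) \ initialPart S a ⊆ ((S.toList.drop a).take q).toFinset := by
    intro x
    simp only [initialPart, List.take_add, List.toFinset_append, Finset.mem_sdiff,
      Finset.mem_union]
    tauto
  refine (Finset.card_le_card this).trans ((List.toFinset_card_le _).trans ?_)
  simp

/-- The number of steps in which one core is built up. -/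
def blockLength (k m : ℕ) : ℕ := k / m ^ 2

/-- The length of a phase: `m` blocks, one for each value of the random index `i`. -/
def phaseLength (k m : ℕ) : ℕ := m * blockLength k m

/-- The size of a core: the arrivals of two phases still fit into a solution. -/
def coreSize (k m : ℕ) : ℕ := k - 2 * phaseLength k m

/-- The part of the solution taken from the cores, `s` steps into phase `j`: up to the `i`-th block
it is the core of the previous phase. Then that core is dropped, and the core of phase `j` is
built up at a rate of `2 * m ^ 2` elements per step. For `j = 0` both cores are empty. -/
noncomputable def coreAt (h : Finset ℕ → ℝ) (k m : ℕ) (c : Fin 3) (i j s : ℕ) : Finset ℕ :=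
  if s < i * blockLength k m then
    core h ((j - 1) * phaseLength k m) (coreSize k m) c
  else
    initialPart (core h (j * phaseLength k m) (coreSize k m) c)
      ((s - i * blockLength k m + 1) * (2 * m ^ 2))

/-- The solution at time `t` in phase `j`, a part of a core together with all arrivals since the
beginning of the previous phase. -/
noncomputable def phaseSolution (h : Finset ℕ → ℝ) (k m : ℕ) (c : Fin 3) (i t j s : ℕ) :
    Finset ℕ :=
  (Finset.range t \ Finset.range ((j - 1) * phaseLength k m)) ∪ coreAt h k m c i j s

/-- The solution after `t` arrivals, as a set of positions in the stream. For small `k` it is an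
optimal solution. -/
noncomputable def schedule (h : Finset ℕ → ℝ) (k m : ℕ) (c : Fin 3) (i t : ℕ) : Finset ℕ :=
  if k < m ^ 2 then argmaxCard (truncate t h) t k
  else phaseSolution h k m c i t (t / phaseLength k m) (t % phaseLength k m)

section Schedule

variable {h : Finset ℕ → ℝ} {k m : ℕ} {c : Fin 3} {i t j s : ℕ}

theorem blockLength_pos (hm : 0 < m) (hk : m ^ 2 ≤ k) : 0 < blockLength k m :=
  Nat.div_pos hk (by positivity)

theorem phaseLength_pos (hm : 0 < m) (hk : m ^ 2 ≤ k) : 0 < phaseLength k m :=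
  Nat.mul_pos hm (blockLength_pos hm hk)

theorem le_blockLength_mul (hm : 0 < m) (hk : m ^ 2 ≤ k) : k ≤ blockLength k m * (2 * m ^ 2) := by
  have h1 := Nat.div_add_mod k (m ^ 2)
  have h2 := Nat.mod_lt k (show 0 < m ^ 2 by positivity)
  have h3 := Nat.mul_le_mul_left (m ^ 2) (blockLength_pos hm hk)
  unfold blockLength at *
  nlinarith

theorem mul_phaseLength_le (k m : ℕ) : m * phaseLength k m ≤ k := by
  have := Nat.mul_div_le k (m ^ 2)
  unfold phaseLength blockLength
  nlinarith

theorem two_mul_phaseLength_le (hm : 2 ≤ m) : 2 * phaseLength k m ≤ k :=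
  (Nat.mul_le_mul_right _ hm).trans (mul_phaseLength_le k m)

theorem coreSize_le (k m : ℕ) : coreSize k m ≤ k := Nat.sub_le _ _

/-- From the end of the `i`-th block on, the core of the phase is complete. -/
theorem coreAt_of_le (hm : 0 < m) (hk : m ^ 2 ≤ k) (hs : (i + 1) * blockLength k m ≤ s + 1) :
    coreAt h k m c i j s = core h (j * phaseLength k m) (coreSize k m) c := by
  have hL := blockLength_pos hm hk
  have hi : i * blockLength k m ≤ s := by rw [add_mul] at hs; omega
  rw [coreAt, if_neg (by omega)]
  apply initialPart_eq_self
  refine (card_core_le _ _ _ _).trans ((coreSize_le k m).trans ?_)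
  refine (le_blockLength_mul hm hk).trans (Nat.mul_le_mul_right _ ?_)
  rw [add_mul] at hs
  omega

theorem coreAt_subset (h : Finset ℕ → ℝ) (k m : ℕ) (c : Fin 3) (i j s : ℕ) :
    coreAt h k m c i j s ⊆ Finset.range (j * phaseLength k m) := by
  unfold coreAt
  split_ifs
  · exact (core_subset _ _ _ _).trans
      (Finset.range_subset_range.2 (Nat.mul_le_mul_right _ (Nat.sub_le _ _)))
  · exact (initialPart_subset _ _).trans (core_subset _ _ _ _)

theorem card_coreAt_le (h : Finset ℕ → ℝ) (k m : ℕ) (c : Fin 3) (i j s : ℕ) :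
    (coreAt h k m c i j s).card ≤ coreSize k m := by
  unfold coreAt
  split_ifs
  · exact card_core_le _ _ _ _
  · exact (Finset.card_le_card (initialPart_subset _ _)).trans (card_core_le _ _ _ _)

theorem schedule_subset (h : Finset ℕ → ℝ) (k m : ℕ) (c : Fin 3) (i t : ℕ) :
    schedule h k m c i t ⊆ Finset.range t := by
  unfold schedule
  split_ifs
  · exact argmaxCard_subset _ _ _
  · exact Finset.union_subset Finset.sdiff_subset ((coreAt_subset _ _ _ _ _ _ _).trans
      (Finset.range_subset_range.2 (Nat.div_mul_le_self _ _)))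

/-- The schedule is online: its solution at time `t` depends only on the values of sets of
arrived elements. -/
theorem schedule_truncate (h : Finset ℕ → ℝ) (k m : ℕ) (c : Fin 3) (i t : ℕ) :
    schedule (truncate t h) k m c i t = schedule h k m c i t := by
  have h1 := Nat.div_mul_le_self t (phaseLength k m)
  have h2 := (Nat.mul_le_mul_right (phaseLength k m)
    (Nat.sub_le (t / phaseLength k m) 1)).trans h1
  simp only [schedule, phaseSolution, coreAt, core_truncate _ _ _ h1, core_truncate _ _ _ h2,
    truncate_truncate le_rfl]

theorem card_schedule_le (hm : 2 ≤ m) : (schedule h k m c i t).card ≤ k := by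
  unfold schedule
  split_ifs with hk
  · exact card_argmaxCard_le _ _ _
  · have hP := phaseLength_pos (by omega : 0 < m) (not_lt.1 hk)
    have h2 := two_mul_phaseLength_le (k := k) hm
    have hwin : (Finset.range t \ Finset.range ((t / phaseLength k m - 1) *
        phaseLength k m)).card ≤ 2 * phaseLength k m := by
      have hsub : Finset.range t \ Finset.range ((t / phaseLength k m - 1) * phaseLength k m) ⊆
          Finset.Ico ((t / phaseLength k m - 1) * phaseLength k m) t := by
        intro a
        simp only [Finset.mem_sdiff, Finset.mem_range, Finset.mem_Ico]
        omega
      refine (Finset.card_le_card hsub).trans ?_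
      have h3 := Nat.div_add_mod' t (phaseLength k m)
      have h4 := Nat.mod_lt t hP
      rw [Nat.card_Ico, Nat.sub_mul, one_mul]
      omega
    refine (Finset.card_union_le _ _).trans ?_
    have := card_coreAt_le h k m c i (t / phaseLength k m) (t % phaseLength k m)
    unfold coreSize at this
    omega

/-- At most `2 * m ^ 2` elements of a core are added per step. -/
theorem card_coreAt_succ_sdiff_le :
    (coreAt h k m c i j (s + 1) \ coreAt h k m c i j s).card ≤ 2 * m ^ 2 := by
  by_cases h1 : s + 1 < i * blockLength k m
  · simp [coreAt, h1, show s < i * blockLength k m by omega]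
  by_cases h2 : s < i * blockLength k m
  · refine (Finset.card_le_card Finset.sdiff_subset).trans ?_
    rw [coreAt, if_neg h1, show s + 1 - i * blockLength k m + 1 = 1 by omega, one_mul]
    exact card_initialPart_le _ _
  · rw [coreAt, if_neg h1, coreAt, if_neg h2,
      show s + 1 - i * blockLength k m + 1 = s - i * blockLength k m + 1 + 1 by omega,
      add_mul (s - i * blockLength k m + 1), one_mul]
    exact card_initialPart_sdiff_le _ _ _

/-- A new phase starts with the core that the previous one has completed, up to the first elements
of the new core in the case `i = 0`. -/
theorem card_coreAt_phase_sdiff_le (hm : 0 < m) (hk : m ^ 2 ≤ k) (hi : i < m)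
    (hs : s + 1 = phaseLength k m) :
    (coreAt h k m c i (j + 1) 0 \ coreAt h k m c i j s).card ≤ 2 * m ^ 2 := by
  have hfull : coreAt h k m c i j s = core h (j * phaseLength k m) (coreSize k m) c :=
    coreAt_of_le hm hk (by rw [hs]; exact Nat.mul_le_mul_right _ hi)
  by_cases h1 : 0 < i * blockLength k m
  · rw [hfull, coreAt, if_pos h1]
    simp
  · refine (Finset.card_le_card Finset.sdiff_subset).trans ?_
    rw [coreAt, if_neg h1, Nat.zero_sub, zero_add, one_mul]
    exact card_initialPart_le _ _

theorem card_phaseSolution_sdiff_le {j' s' : ℕ} (hj : j ≤ j') {q : ℕ}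
    (hq : (coreAt h k m c i j' s' \ coreAt h k m c i j s).card ≤ q) :
    (phaseSolution h k m c i (t + 1) j' s' \ phaseSolution h k m c i t j s).card ≤ q + 1 := by
  have : phaseSolution h k m c i (t + 1) j' s' \ phaseSolution h k m c i t j s ⊆
      insert t (coreAt h k m c i j' s' \ coreAt h k m c i j s) := by
    intro x
    have := Nat.mul_le_mul_right (phaseLength k m) (Nat.sub_le_sub_right hj 1)
    simp only [phaseSolution, Finset.mem_sdiff, Finset.mem_union, Finset.mem_insert,
      Finset.mem_range]
    grind
  exact (Finset.card_le_card this).trans ((Finset.card_insert_le _ _).trans (by omega))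

theorem card_schedule_succ_sdiff_le (hm : 0 < m) (hi : i < m) :
    (schedule h k m c i (t + 1) \ schedule h k m c i t).card ≤ 3 * m ^ 2 := by
  have hm2 : 0 < m ^ 2 := by positivity
  by_cases hk : k < m ^ 2
  · refine (Finset.card_le_card Finset.sdiff_subset).trans ?_
    rw [schedule, if_pos hk]
    have := card_argmaxCard_le (truncate (t + 1) h) (t + 1) k
    omega
  have hP := phaseLength_pos hm (not_lt.1 hk)
  have hlt := Nat.mod_lt t hP
  have hdm := Nat.div_add_mod t (phaseLength k m)
  rw [schedule, if_neg hk, schedule, if_neg hk]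
  suffices h0 : (coreAt h k m c i ((t + 1) / phaseLength k m) ((t + 1) % phaseLength k m) \
      coreAt h k m c i (t / phaseLength k m) (t % phaseLength k m)).card ≤ 2 * m ^ 2 by
    have := card_phaseSolution_sdiff_le (t := t)
      (Nat.div_le_div_right (c := phaseLength k m) (by omega : t ≤ t + 1)) h0
    omega
  rcases (Nat.succ_le_of_lt hlt).lt_or_eq with hs | hs
  · obtain ⟨h1, h2⟩ := (Nat.div_mod_unique (a := t + 1) (d := t / phaseLength k m)
      (c := t % phaseLength k m + 1) hP).2 ⟨by omega, hs⟩
    rw [h1, h2]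
    exact card_coreAt_succ_sdiff_le
  · obtain ⟨h1, h2⟩ := (Nat.div_mod_unique (a := t + 1) (d := t / phaseLength k m + 1)
      (c := 0) hP).2 ⟨by rw [mul_add]; omega, hP⟩
    rw [h1, h2]
    exact card_coreAt_phase_sdiff_le hm (not_lt.1 hk) hi hs

/-- Unless a core is under construction, the solution with a random core is nearly a
`2/3`-approximation. -/
theorem LatticeSubmodular.sum_schedule_ge (hh : LatticeSubmodular h) (hm : 0 < m)
    (hk : m ^ 2 ≤ k) (hi : i ≠ t % phaseLength k m / blockLength k m) {Q : Finset ℕ}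
    (hQt : Q ⊆ Finset.range t) (hQ : Q.card ≤ k) :
    2 * ((coreSize k m : ℝ) / k * h Q) ≤ ∑ c : Fin 3, h (schedule h k m c i t) := by
  have hL := blockLength_pos hm hk
  have hk0 : 0 < k := lt_of_lt_of_le (by positivity) hk
  -- The core is the complete core of phase `j'`, the previous one or the current one.
  obtain ⟨j', hj', hcore⟩ : ∃ j', t / phaseLength k m - 1 ≤ j' ∧
      ∀ c, coreAt h k m c i (t / phaseLength k m) (t % phaseLength k m) =
        core h (j' * phaseLength k m) (coreSize k m) c := by
    rcases lt_or_gt_of_ne hi with hlt | hgt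
    · refine ⟨_, Nat.sub_le _ _, fun c => coreAt_of_le hm hk ?_⟩
      exact ((Nat.le_div_iff_mul_le hL).1 (Nat.succ_le_of_lt hlt)).trans (Nat.le_succ _)
    · refine ⟨_, le_rfl, fun c => ?_⟩
      rw [coreAt, if_pos ((Nat.div_lt_iff_lt_mul hL).1 hgt)]
  refine (hh.sum_core_ge (coreSize_le k m) hk0 (N := j' * phaseLength k m)
    (R := Finset.range t \ Finset.range ((t / phaseLength k m - 1) * phaseLength k m))
    hQ ?_).trans_eq ?_
  · intro x hx
    have h1 := hQt hx
    have h2 := Nat.mul_le_mul_right (phaseLength k m) hj'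
    simp only [Finset.mem_union, Finset.mem_sdiff, Finset.mem_range] at h1 ⊢
    omega
  · refine Finset.sum_congr rfl fun c _ => ?_
    rw [schedule, if_neg (not_lt.2 hk), phaseSolution, hcore]

/-- The average of the schedule over its random indices, against any feasible set `Q`. -/
theorem LatticeSubmodular.average_schedule_ge (hh : LatticeSubmodular h) (hm : 2 ≤ m)
    {Q : Finset ℕ} (hQt : Q ⊆ Finset.range t) (hQ : Q.card ≤ k) :
    (2 / 3 - 2 / m) * h Q ≤
      (∑ p : Fin 3 × Fin m, h (schedule h k m p.1 p.2 t)) / (3 * m) := by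
  have hm' : (2 : ℝ) ≤ m := by exact_mod_cast hm
  rw [le_div_iff₀ (by positivity), Fintype.sum_prod_type_right]
  have e : (2 / 3 - 2 / (m : ℝ)) * h Q * (3 * m) = (2 * m - 6) * h Q := by
    field_simp
    ring
  rw [e]
  have hQ0 := hh.nonneg Q
  by_cases hk : k < m ^ 2
  · have hle : h Q ≤ h (argmaxCard (truncate t h) t k) := by
      have := le_argmaxCard (truncate t h) t k hQt hQ
      rwa [truncate_apply hQt, truncate_apply (argmaxCard_subset _ _ _)] at this
    simp only [schedule, if_pos hk, Finset.sum_const, Finset.card_univ, Fintype.card_fin,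
      nsmul_eq_mul]
    push_cast
    nlinarith
  rw [not_lt] at hk
  have hk0 : (0 : ℝ) < k := by exact_mod_cast lt_of_lt_of_le (by positivity : 0 < m ^ 2) hk
  have hθ : 1 - 2 / (m : ℝ) ≤ (coreSize k m : ℝ) / k := by
    have h1 : ((m * phaseLength k m : ℕ) : ℝ) ≤ k := by exact_mod_cast mul_phaseLength_le k m
    rw [coreSize, Nat.cast_sub (two_mul_phaseLength_le hm), sub_div, div_self hk0.ne']
    have h2 : ((2 * phaseLength k m : ℕ) : ℝ) / k ≤ 2 / m := by
      rw [div_le_div_iff₀ hk0 (by positivity)]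
      push_cast at h1 ⊢
      nlinarith
    linarith
  -- The sum runs over all indices `i` but the one, if any, whose core is under construction.
  set B := t % phaseLength k m / blockLength k m
  have hsum : ∑ i : Fin m, (if (i : ℕ) = B then 0 else 2 * ((coreSize k m : ℝ) / k * h Q)) ≤
      ∑ i : Fin m, ∑ c : Fin 3, h (schedule h k m c i t) := by
    refine Finset.sum_le_sum fun i _ => ?_
    split_ifs with hi
    · exact Finset.sum_nonneg fun c _ => hh.nonneg _
    · exact hh.sum_schedule_ge (by omega) hk hi hQt hQ
  refine le_trans ?_ hsum
  have hcard : ((m : ℝ) - 1) ≤ (Finset.univ.filter (fun i : Fin m => ¬ (i : ℕ) = B)).card := by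
    have h1 := Finset.card_filter_add_card_filter_not (s := (Finset.univ : Finset (Fin m)))
      (fun i : Fin m => (i : ℕ) = B)
    have h2 : (Finset.univ.filter (fun i : Fin m => (i : ℕ) = B)).card ≤ 1 := by
      rw [Finset.card_le_one]
      intro a ha b hb
      simp only [Finset.mem_filter] at ha hb
      exact Fin.ext (ha.2.trans hb.2.symm)
    rw [Finset.card_univ, Fintype.card_fin] at h1
    have : (m : ℝ) ≤
        ((1 + (Finset.univ.filter (fun i : Fin m => ¬ (i : ℕ) = B)).card : ℕ) : ℝ) := by
      exact_mod_cast (by omega)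
    push_cast at this
    linarith
  rw [Finset.sum_ite, Finset.sum_const_zero, zero_add, Finset.sum_const, nsmul_eq_mul]
  have hθ0 : (0 : ℝ) ≤ (coreSize k m : ℝ) / k := by positivity
  have h1 : (1 - 2 / (m : ℝ)) * h Q ≤ (coreSize k m : ℝ) / k * h Q :=
    mul_le_mul_of_nonneg_right hθ hQ0
  have h2 := mul_le_mul_of_nonneg_right hcard
    (by positivity : 0 ≤ 2 * ((coreSize k m : ℝ) / k * h Q))
  refine le_trans ?_ h2
  have h3 := mul_le_mul_of_nonneg_left h1 (by linarith : (0 : ℝ) ≤ 2 * (m - 1))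
  have e2 : 2 * ((m : ℝ) - 1) * ((1 - 2 / m) * h Q) = (2 * m - 6) * h Q + 4 / m * h Q := by
    field_simp
    ring
  have h4 : 0 ≤ 4 / (m : ℝ) * h Q := by positivity
  linarith

end Schedule

/-! ### The online algorithm -/

section Algorithm

/-- The set of elements of a stream at the positions in `S`. -/
def streamSet {X : Type*} {n : ℕ} (x : Fin n ≃ X) (S : Finset ℕ) : Finset X :=
  (Finset.univ.filter (fun i : Fin n => (i : ℕ) ∈ S)).map x.toEmbedding

/-- A value oracle for the first `t` elements, as a function on sets of positions. -/
def extendOracle {t : ℕ} (v : Finset (Fin t) → ℝ) : Finset ℕ → ℝ :=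
  fun S => v (Finset.univ.filter (fun i : Fin t => (i : ℕ) ∈ S))

/-- The algorithm that follows the schedule with uniformly random indices. -/
noncomputable def scheduleAlgorithm (m : ℕ) [NeZero m] : RandomizedOnlineAlgorithm where
  Ω := Fin 3 × Fin m
  measurableSpace := ⊤
  law := @PMF.toMeasure _ ⊤ (PMF.uniformOfFintype (Fin 3 × Fin m))
  isProbabilityMeasure := @PMF.toMeasure.isProbabilityMeasure _ ⊤ _
  select k ω t v :=
    Finset.univ.filter (fun i : Fin t => (i : ℕ) ∈ schedule (extendOracle v) k m ω.1 ω.2 t)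
  measurableSet_select _ _ _ _ := trivial

variable {X : Type*} {n t k : ℕ}

theorem mem_streamSet {x : Fin n ≃ X} {S : Finset ℕ} {a : X} :
    a ∈ streamSet x S ↔ (x.symm a : ℕ) ∈ S := by
  simp only [streamSet, Finset.mem_map, Finset.mem_filter, Finset.mem_univ, true_and,
    Equiv.coe_toEmbedding]
  constructor
  · rintro ⟨i, hi, rfl⟩
    simpa using hi
  · exact fun ha => ⟨_, ha, by simp⟩

theorem card_streamSet_le (x : Fin n ≃ X) (S : Finset ℕ) : (streamSet x S).card ≤ S.card := by
  rw [streamSet, Finset.card_map]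
  refine Finset.card_le_card_of_injOn Fin.val ?_ Fin.val_injective.injOn
  intro i hi
  simpa using hi

theorem LatticeSubmodular.comp_streamSet [DecidableEq X] {f : Finset X → ℝ}
    (hf : LatticeSubmodular f) (x : Fin n ≃ X) :
    LatticeSubmodular (fun S => f (streamSet x S)) := by
  refine ⟨fun S => hf.nonneg _, fun A B hAB => hf.mono _ _ ?_, fun A B => ?_⟩
  · exact fun a ha => mem_streamSet.2 (hAB (mem_streamSet.1 ha))
  · have h1 : streamSet x (A ∪ B) = streamSet x A ∪ streamSet x B := by
      ext a
      simp [mem_streamSet]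
    have h2 : streamSet x (A ∩ B) = streamSet x A ∩ streamSet x B := by
      ext a
      simp [mem_streamSet]
    simp only [h1, h2]
    exact hf.union_inter _ _

theorem map_arrival (x : Fin n ≃ X) (ht : t ≤ n) (S : Finset ℕ) :
    (Finset.univ.filter (fun i : Fin t => (i : ℕ) ∈ S)).map (arrival x ht) =
      streamSet x (S ∩ Finset.range t) := by
  ext a
  simp only [mem_streamSet, Finset.mem_map, Finset.mem_filter, Finset.mem_univ, true_and,
    Finset.mem_inter, Finset.mem_range]
  constructor
  · rintro ⟨i, hi, rfl⟩
    simpa [arrival] using hi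
  · rintro ⟨h1, h2⟩
    exact ⟨⟨_, h2⟩, h1, by simp [arrival]⟩

theorem solution_scheduleAlgorithm {m : ℕ} [NeZero m] (f : Finset X → ℝ) (x : Fin n ≃ X)
    (ht : t ≤ n) (ω : Fin 3 × Fin m) :
    (scheduleAlgorithm m).solution k f x ht ω =
      streamSet x (schedule (fun S => f (streamSet x S)) k m ω.1 ω.2 t) := by
  have h1 : extendOracle (valueOracle f x ht) = truncate t (fun S => f (streamSet x S)) := by
    funext S
    simp only [extendOracle, valueOracle, truncate, map_arrival]
  simp only [RandomizedOnlineAlgorithm.solution, scheduleAlgorithm]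
  rw [map_arrival, h1, schedule_truncate, Finset.inter_eq_left.2 (schedule_subset _ _ _ _ _ _)]

theorem exists_optValue_eq (k : ℕ) (f : Finset X → ℝ) (x : Fin n ≃ X) (ht : t ≤ n) :
    ∃ Q ⊆ Finset.range t, Q.card ≤ k ∧ optValue k f x ht = f (streamSet x Q) := by
  obtain ⟨S, hS, hv⟩ := Finset.exists_mem_eq_sup'
    (s := (arrivedSet x ht).powerset.filter (fun S => S.card ≤ k)) ⟨∅, by simp⟩ f
  simp only [Finset.mem_filter, Finset.mem_powerset] at hS
  refine ⟨S.map (x.symm.toEmbedding.trans Fin.valEmbedding), ?_, by simpa using hS.2, ?_⟩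
  · intro i hi
    simp only [Finset.mem_map] at hi
    obtain ⟨a, ha, rfl⟩ := hi
    have := hS.1 ha
    simp only [arrivedSet, Finset.mem_map, Finset.mem_univ, true_and] at this
    obtain ⟨i, rfl⟩ := this
    simp [arrival]
  · rw [optValue, hv]
    congr 1
    ext a
    rw [mem_streamSet]
    simp only [Finset.mem_map]
    constructor
    · exact fun ha => ⟨a, ha, rfl⟩
    · rintro ⟨b, hb, hba⟩
      have : x.symm b = x.symm a := Fin.ext hba
      rwa [← x.symm.injective this]

theorem integral_scheduleAlgorithm {m : ℕ} [NeZero m] (F : Fin 3 × Fin m → ℝ) :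
    ∫ ω, F ω ∂(scheduleAlgorithm m).law = (∑ p, F p) / (3 * m) := by
  let : MeasurableSpace (Fin 3 × Fin m) := ⊤
  change ∫ ω, F ω ∂(PMF.uniformOfFintype (Fin 3 × Fin m)).toMeasure = _
  rw [PMF.integral_eq_sum, Finset.sum_div]
  refine Finset.sum_congr rfl fun p _ => ?_
  rw [PMF.uniformOfFintype_apply]
  simp [div_eq_inv_mul]

universe w

theorem scheduleAlgorithm_isFeasible {m : ℕ} [NeZero m] (hm : 2 ≤ m) :
    RandomizedOnlineAlgorithm.IsFeasible.{w} (scheduleAlgorithm m) := by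
  intro k n X _ x f _ t ht ω
  rw [solution_scheduleAlgorithm f x ht ω]
  exact (card_streamSet_le _ _).trans (card_schedule_le hm)

theorem scheduleAlgorithm_isConsistent {m : ℕ} [NeZero m] :
    RandomizedOnlineAlgorithm.IsConsistent.{w} (scheduleAlgorithm m) (3 * (m : ℝ) ^ 2) := by
  intro k n X _ x f _ t ht ω
  rw [solution_scheduleAlgorithm f x ht ω, solution_scheduleAlgorithm f x _ ω]
  have h1 : ∀ S T : Finset ℕ, streamSet x S \ streamSet x T = streamSet x (S \ T) := by
    intro S T
    ext a
    simp [mem_streamSet]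
  rw [h1]
  have h2 := (card_streamSet_le x _).trans (card_schedule_succ_sdiff_le
    (h := fun S => f (streamSet x S)) (k := k) (c := ω.1) (t := t) (NeZero.pos m) ω.2.2)
  exact_mod_cast h2

theorem scheduleAlgorithm_isApproximation {m : ℕ} [NeZero m] (hm : 2 ≤ m) :
    RandomizedOnlineAlgorithm.IsApproximation.{w} (scheduleAlgorithm m) (2 / 3 - 2 / m) := by
  intro k n X _ x f hf t ht
  obtain ⟨Q, hQt, hQ, hv⟩ := exists_optValue_eq k f x ht
  rw [hv]
  refine ((hf.latticeSubmodular.comp_streamSet x).average_schedule_ge hm hQt hQ).trans_eq ?_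
  rw [← integral_scheduleAlgorithm]
  refine integral_congr_ae (Filter.Eventually.of_forall fun ω => ?_)
  simp only [solution_scheduleAlgorithm f x ht ω]

end Algorithm

theorem theorem5p1 :
    ∃ C K : ℝ, 0 < C ∧ 0 < K ∧ ∀ ε : ℝ, 0 < ε → ε < 1 →
      ∃ A : RandomizedOnlineAlgorithm,
        RandomizedOnlineAlgorithm.IsFeasible.{u} A ∧
        RandomizedOnlineAlgorithm.IsConsistent.{u} A (C / ε ^ 2) ∧
        RandomizedOnlineAlgorithm.IsApproximation.{u} A (2 / 3 - K * ε) := by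
  refine ⟨12, 2, by norm_num, by norm_num, fun ε h0 h1 => ?_⟩
  set m := ⌈ε⁻¹⌉₊ with hmdef
  have hinv : 1 < ε⁻¹ := (one_lt_inv₀ h0).2 h1
  have hge : ε⁻¹ ≤ m := Nat.le_ceil _
  have hlt : (m : ℝ) < ε⁻¹ + 1 := Nat.ceil_lt_add_one (by positivity)
  have hm : 2 ≤ m := by
    have : (1 : ℝ) < m := hinv.trans_le hge
    exact_mod_cast this
  have : NeZero m := ⟨by omega⟩
  refine ⟨scheduleAlgorithm m, scheduleAlgorithm_isFeasible hm, ?_, ?_⟩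
  · intro k n X _ x f hf t ht ω
    refine (scheduleAlgorithm_isConsistent k n X x f hf t ht ω).trans ?_
    have h2 : (m : ℝ) ≤ 2 * ε⁻¹ := by linarith
    have h3 : (m : ℝ) ^ 2 ≤ (2 * ε⁻¹) ^ 2 := pow_le_pow_left₀ (by positivity) h2 2
    have h4 : 12 / ε ^ 2 = 3 * (2 * ε⁻¹) ^ 2 := by
      field_simp
      norm_num
    linarith
  · intro k n X _ x f hf t ht
    refine le_trans ?_ (scheduleAlgorithm_isApproximation hm k n X x f hf t ht)
    obtain ⟨Q, -, -, hv⟩ := exists_optValue_eq k f x ht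
    refine mul_le_mul_of_nonneg_right ?_ (hv ▸ hf.nonneg _)
    have : 2 / (m : ℝ) ≤ 2 * ε := by
      rw [div_le_iff₀ (by positivity)]
      have := mul_le_mul_of_nonneg_left hge h0.le
      rw [mul_inv_cancel₀ h0.ne'] at this
      linarith
    linarith
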